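/- Let $q$ be an indeterminate, let $(z)_k=\prod_{i=0}^{k-1}(1-zq^i)$, and let $\begin{bmatrix} N\\ m\end{bmatrix}_q=\frac{(q)_N}{(q)_m(q)_{N-m}}$ for $0\le m\le N$ and $0$ otherwise. For a sequence $a=(a_1,\dots,a_n)$ of positive integers put $|a|=a_1+\cdots+a_n$, $\sigma_i=a_1+\cdots+a_i$ and \[x^{(a)}=(x_1,x_1q,\dots,x_1q^{a_1-1},\dots,x_n,x_nq,\dots,x_nq^{a_n-1}).\] For $v=(v_1,\dots,v_n)$ a sequence of nonnegative integers and $\mu$ a partition with at most $|a|$ parts, let \[D_{v,\mu}(a)=\mathrm{CT}\bigg[x^{-v}\,s_\mu\big(x^{(a)}\big)\prod_{1\le i<j\le n}(x_i/x_j)_{a_i}(qx_j/x_i)_{a_j}\bigg],\] where $\mathrm{CT}$ denotes the constant term of a Laurent polynomial in $x_1,\dots,x_n$ over $\mathbb{Q}(q)$, $x^{-v}=x_1^{-v_1}\cdots x_n^{-v_n}$, and $s_\mu(y_1,\dots,y_N)=\det(y_i^{\mu_j+N-j})_{1\le i,j\le N}/\prod_{1\le i<j\le N}(y_i-y_j)$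 is the Schur function (with $N=|a|$, $\mu$ being extended by zeros to length $N$). Write $D_v(a)=D_{v,v^+}(a)$, where $v^+$ is the weakly decreasing rearrangement of $v$. For $w\in\mathfrak{S}_n$ and a sequence $b$ of length $n$ let $w(b)=(b_{w(1)},\dots,b_{w(n)})$, and let $R(w)=\{(i,j): 1\le i<j\le n,\ w^{-1}(i)>w^{-1}(j)\}$. Let $\lambda=(\lambda_1,\dots,\lambda_n)$ be a strict partition, i.e., integers $\lambda_1>\lambda_2>\cdots>\lambda_n\ge 0$, and set $\bar\lambda=(\lambda_n,\dots,\lambda_1)$. Then, for all positive integers $a_1,\dots,a_n$ and all $w\in\mathfrak{S}_n$, \[D_{w^{-1}(\bar\lambda)}(a)=w\bigg(\prod_{i=1}^n\begin{bmatrix}\bar\lambda_i+\sigma_i-1\\ a_i-1\end{bmatrix}_q\bigg)\,q^{\sum_{(i,j)\in R(w)}a_j},\] where $w$ acts on the product by permuting the $a_i$ only, i.e., \[w\bigg(\prod_{i=1}^n\begin{bmatrix}\bar\lambda_i+\sigma_i-1\\ a_i-1\end{bmatrix}_q\bigg) =\prod_{i=1}^n\begin{bmatrix}\bar\lambda_i+a_{w(1)}+\cdots+a_{w(i)}-1\\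 a_{w(i)}-1\end{bmatrix}_q.\] In particular, \[D_{\lambda,\lambda}(a)=q^{\sum_{1\le i<j\le n}a_j}\prod_{i=1}^n\begin{bmatrix}\lambda_i+a_i+\cdots+a_n-1\\ a_i-1\end{bmatrix}_q.\] -/

import Mathlib

namespace QDyson

noncomputable section

/-- The set of pairs `(i, j)` with `1 ≤ i < j ≤ n`. -/
def pairs (n : ℕ) : Finset (Fin n × Fin n) :=
  Finset.univ.filter fun p => p.1 < p.2

/-- The inversion set `I(w)` of a permutation: pairs `i < j` with `w(i) > w(j)`. -/
def inversionSet {n : ℕ} (w : Equiv.Perm (Fin n)) : Finset (Fin n × Fin n) :=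
  (pairs n).filter fun p => w p.2 < w p.1

/-- `R(w) = I(w⁻¹)`. -/
def R {n : ℕ} (w : Equiv.Perm (Fin n)) : Finset (Fin n × Fin n) :=
  inversionSet w⁻¹

/-- The partial sum `σ_i = a_1 + ⋯ + a_i`. -/
def partialSum {n : ℕ} (a : Fin n → ℕ) (i : Fin n) : ℕ :=
  ∑ k ∈ Finset.Iic i, a k

/-- The reversal `(v_n, …, v_1)` of a sequence `(v_1, …, v_n)`. -/
def bar {n : ℕ} (v : Fin n → ℕ) : Fin n → ℕ := fun i => v i.rev

/-- The action `w(b) = (b_{w(1)}, …, b_{w(n)})` of a permutation on sequences. -/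
def permute {n : ℕ} (w : Equiv.Perm (Fin n)) (b : Fin n → ℕ) : Fin n → ℕ := fun i => b (w i)

/-- The weakly decreasing rearrangement `v⁺` of a composition `v`. -/
def dominant {n : ℕ} (v : Fin n → ℕ) : Fin n → ℕ :=
  fun i => v (Tuple.sort v i.rev)

theorem dominant_antitone {n : ℕ} (v : Fin n → ℕ) : Antitone (dominant v) :=
  fun _ _ h => Tuple.monotone_sort v (Fin.rev_le_rev.mpr h)

/-- The sequence `lam` regarded as a sequence of length `N ≥ n` by appending zeros. -/
def pad {n : ℕ} (N : ℕ) (lam : Fin n → ℕ) : Fin N → ℕ :=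
  fun k => if h : (k : ℕ) < n then lam ⟨k, h⟩ else 0

/-! ### Schur polynomials -/

/-- The alternant `det (x_i ^ (lam_j + N - j))`, with `1 ≤ i, j ≤ N`. -/
def alternant {N : ℕ} (lam : Fin N → ℕ) : MvPolynomial (Fin N) ℤ :=
  (Matrix.of fun i j : Fin N => MvPolynomial.X i ^ (lam j + (N - 1 - (j : ℕ)))).det

/-- The product `∏_{i < j} (x_i - x_j)`. -/
def vandermondeProd (N : ℕ) : MvPolynomial (Fin N) ℤ :=
  ∏ p ∈ pairs N, (MvPolynomial.X p.1 - MvPolynomial.X p.2)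

/-- The substitution `x_j := x_i`. -/
def identify {N : ℕ} (i j : Fin N) : MvPolynomial (Fin N) ℤ →ₐ[ℤ] MvPolynomial (Fin N) ℤ :=
  MvPolynomial.aeval fun k => if k = j then MvPolynomial.X i else MvPolynomial.X k

theorem dvd_of_identify_eq_zero {N : ℕ} (i j : Fin N) (f : MvPolynomial (Fin N) ℤ)
    (hf : identify i j f = 0) : (MvPolynomial.X i - MvPolynomial.X j) ∣ f := by
  let I : Ideal (MvPolynomial (Fin N) ℤ) := Ideal.span {MvPolynomial.X i - MvPolynomial.X j}
  have h : (Ideal.Quotient.mkₐ ℤ I).comp (identify i j) = Ideal.Quotient.mkₐ ℤ I := by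
    apply MvPolynomial.algHom_ext
    intro k
    by_cases hk : k = j
    · subst hk
      simp only [identify, AlgHom.comp_apply, MvPolynomial.aeval_X, if_true,
        Ideal.Quotient.mkₐ_eq_mk]
      exact Ideal.Quotient.eq.mpr (Ideal.subset_span rfl)
    · simp [identify, hk]
  have h2 := DFunLike.congr_fun h f
  rw [AlgHom.comp_apply, hf, map_zero, Ideal.Quotient.mkₐ_eq_mk] at h2
  exact Ideal.mem_span_singleton.mp (Ideal.Quotient.eq_zero_iff_mem.mp h2.symm)

theorem irreducible_X_sub_X {N : ℕ} {i j : Fin N} (hij : i ≠ j) :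
    Irreducible (MvPolynomial.X i - MvPolynomial.X j : MvPolynomial (Fin N) ℤ) := by
  have hc : (MvPolynomial.X i - MvPolynomial.X j : MvPolynomial (Fin N) ℤ).coeff
      (Finsupp.single i 1) = 1 := by
    simp [MvPolynomial.coeff_X, hij.symm, Finsupp.single_left_inj]
  apply MvPolynomial.irreducible_of_totalDegree_eq_one
  · apply le_antisymm
    · exact (MvPolynomial.totalDegree_sub _ _).trans (by simp)
    · have := MvPolynomial.le_totalDegree (s := Finsupp.single i 1)
        (MvPolynomial.mem_support_iff.mpr (hc.trans_ne one_ne_zero))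
      simpa using this
  · intro x hx
    exact isUnit_of_dvd_one (hc ▸ hx (Finsupp.single i 1))

theorem vandermondeProd_dvd_alternant {N : ℕ} (lam : Fin N → ℕ) :
    vandermondeProd N ∣ alternant lam := by
  apply Finset.prod_dvd_of_isRelPrime
  · rintro ⟨i, j⟩ hij ⟨k, l⟩ hkl hne
    have hij' : i < j := by simpa [pairs] using hij
    have hkl' : k < l := by simpa [pairs] using hkl
    refine (irreducible_X_sub_X hij'.ne).isRelPrime_iff_not_dvd.mpr ?_
    rintro ⟨g, hg⟩
    have h := congrArg (identify i j) hg
    simp only [identify, map_mul, map_sub, MvPolynomial.aeval_X, if_true, hij'.ne, if_false,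
      sub_self, zero_mul, sub_eq_zero] at h
    apply hne
    split_ifs at h with h1 h2 h2 <;>
      simp only [MvPolynomial.X_injective.eq_iff] at h <;> grind
  · rintro ⟨i, j⟩ hij
    have hij' : i < j := by simpa [pairs] using hij
    apply dvd_of_identify_eq_zero
    rw [alternant, AlgHom.map_det]
    apply Matrix.det_zero_of_row_eq hij'.ne
    funext k
    simp [identify, hij'.ne]

/-- The Schur polynomial `s_lam(x_1, …, x_N)`, i.e. the quotient of `det (x_i ^ (lam_j + N - j))`
by `∏_{i < j} (x_i - x_j)`; see `schur_mul_vandermondeProd`. -/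
def schur {N : ℕ} (lam : Fin N → ℕ) : MvPolynomial (Fin N) ℤ :=
  (vandermondeProd_dvd_alternant lam).choose

theorem schur_mul_vandermondeProd {N : ℕ} (lam : Fin N → ℕ) :
    schur lam * vandermondeProd N = alternant lam := by
  rw [mul_comm]
  exact (vandermondeProd_dvd_alternant lam).choose_spec.symm

/-! ### `q`-shifted factorials, `q`-binomial coefficients and constant terms -/

/-- The coefficient field `ℚ(q)`. -/
abbrev K : Type := RatFunc ℚ

/-- The indeterminate `q`. -/
def q : K := RatFunc.X

/-- The `q`-shifted factorial `(z)_k = ∏_{i=0}^{k-1} (1 - z q^i)`. -/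
def qPoch {A : Type} [CommRing A] [Algebra K A] (z : A) (k : ℕ) : A :=
  ∏ i ∈ Finset.range k, (1 - z * algebraMap K A (q ^ i))

/-- The `q`-binomial coefficient. -/
def qbin (n m : ℕ) : K :=
  if m ≤ n then qPoch q n / (qPoch q m * qPoch q (n - m)) else 0

/-- Laurent polynomials in `x_1, …, x_n` over `ℚ(q)`. -/
abbrev Laurent (n : ℕ) : Type := AddMonoidAlgebra K (Fin n → ℤ)

/-- The Laurent monomial `x^u = x_1^{u_1} ⋯ x_n^{u_n}`. -/
def mono {n : ℕ} (u : Fin n → ℤ) : Laurent n := AddMonoidAlgebra.single u 1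

/-- The ratio `x_i / x_j`. -/
def ratio {n : ℕ} (i j : Fin n) : Laurent n := mono (Pi.single i 1 - Pi.single j 1)

/-- The constant term of a Laurent polynomial. -/
def CT {n : ℕ} (f : Laurent n) : K := f.coeff 0

/-- The alphabet `(x_1, x_1 q, …, x_1 q^{a_1-1}, …, x_n, x_n q, …, x_n q^{a_n-1})`
of length `a_1 + ⋯ + a_n`. -/
def alphabet {n : ℕ} (a : Fin n → ℕ) : Fin (∑ i, a i) → Laurent n := fun k =>
  mono (Pi.single (finSigmaFinEquiv.symm k).1 1) *
    algebraMap K (Laurent n) (q ^ ((finSigmaFinEquiv.symm k).2 : ℕ))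

/-- The `q`-Dyson product `∏_{i < j} (x_i/x_j)_{a_i} (q x_j/x_i)_{a_j}`. -/
def dysonProd {n : ℕ} (a : Fin n → ℕ) : Laurent n :=
  ∏ p ∈ pairs n, qPoch (ratio p.1 p.2) (a p.1) *
    qPoch (algebraMap K (Laurent n) q * ratio p.2 p.1) (a p.2)

/-- The constant term `D_{v,lam}(a)` of `x^{-v}` times the Schur polynomial `s_lam` in the above
alphabet times the `q`-Dyson product; `lam` has length `|a| = a_1 + ⋯ + a_n`. -/
def D₂ {n : ℕ} (v : Fin n → ℕ) (a : Fin n → ℕ) (lam : Fin (∑ i, a i) → ℕ) : K :=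
  CT (mono (fun i => -(v i : ℤ)) * MvPolynomial.aeval (alphabet a) (schur lam) * dysonProd a)

/-- `D_v(a) = D_{v,v⁺}(a)`, for positive `a_i` (so that `n ≤ |a|`). -/
def D {n : ℕ} (v : Fin n → ℕ) (a : Fin n → ℕ) : K :=
  D₂ v a (pad (∑ i, a i) (dominant v))

end

end QDyson

/-!
Since the parts of `λ` are distinct, exactly one variable `x_i` has the exponent `v_i = λ_1`.
Laplace expansion of the alternant of `s_λ` along the column of `λ_1` writes `s_λ` as a sum over the
letters `y = x_j q ^ k` of the alphabet, the term of `y` being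
`y ^ (λ_1 + |a| - 1) / ∏ (y - y')`, the product over the other letters `y'`, times the Schur
polynomial of `(λ_2, …, λ_n)` in these letters. The `q`-Dyson product cancels the denominators and
turns the term into `x_j ^ λ_1` times a polynomial in `x_j` whose coefficients are Laurent
polynomials in the other variables. The terms with `v_j < λ_1` therefore have vanishing constant
term after multiplication by `x ^ (-v)`, and in those with `j = i` one may set `x_i = 0` in the
polynomial: this removes `x_i` from both the `q`-Dyson product and the alphabet, up to a power of
`q`. The remaining sum over `k`, of `(q ^ k) ^ r / ∏_{l ≠ k} (q ^ k - q ^ l)`, is a divided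
difference of a power at the nodes `1, q, …, q ^ (a_i - 1)`, hence a `q`-binomial coefficient.
Iteration removes the variables in the order `x_{w(n)}, …, x_{w(1)}`.
-/

namespace QDyson

noncomputable section

open Finset

section Pairs

variable {M : Type*} [CommMonoid M]

@[to_additive]
theorem prod_pairs_eq_prod_ite (n : ℕ) (g : Fin n → Fin n → M) :
    ∏ p ∈ pairs n, g p.1 p.2 = ∏ i, ∏ j, if i < j then g i j else 1 := by
  rw [pairs, prod_filter, ← univ_product_univ, prod_product]

@[to_additive]
theorem prod_pairs_succ {n : ℕ} (i : Fin (n + 1)) (g : Fin (n + 1) → Fin (n + 1) → M) :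
    ∏ p ∈ pairs (n + 1), g p.1 p.2 =
      (∏ j, if i < i.succAbove j then g i (i.succAbove j) else g (i.succAbove j) i) *
        ∏ p ∈ pairs n, g (i.succAbove p.1) (i.succAbove p.2) := by
  rw [prod_pairs_eq_prod_ite, prod_pairs_eq_prod_ite n fun k l => g (i.succAbove k) (i.succAbove l),
    Fin.prod_univ_succAbove _ i]
  simp_rw [Fin.prod_univ_succAbove (fun j => if _ < j then _ else _) i]
  simp only [prod_mul_distrib, lt_self_iff_false, if_false, one_mul, Fin.succAbove_lt_succAbove_iff]
  rw [← mul_assoc, ← prod_mul_distrib]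
  congr 1
  refine prod_congr rfl fun j _ => ?_
  rcases (i.succAbove_ne j).lt_or_gt with h | h <;> simp [h, h.not_gt]

@[to_additive]
theorem prod_ite_lt_succAbove {n : ℕ} (i : Fin (n + 1)) (f g : Fin (n + 1) → M) :
    (∏ j, if i < i.succAbove j then f (i.succAbove j) else g (i.succAbove j)) =
      (∏ j ∈ Iio i, g j) * ∏ j ∈ Ioi i, f j := by
  have hfilter : ({i}ᶜ : Finset (Fin (n + 1))) = Iio i ∪ Ioi i := by
    ext j
    simp [lt_or_lt_iff_ne]
  have hdisj : Disjoint (Iio i) (Ioi i) :=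
    disjoint_left.mpr fun j hj hj' => (mem_Iio.mp hj).not_gt (mem_Ioi.mp hj')
  rw [← prod_image (f := fun j => if i < j then f j else g j) i.succAbove_right_injective.injOn,
    Fin.image_succAbove_univ, hfilter, prod_union hdisj]
  congr 1
  · exact prod_congr rfl fun j hj => if_neg (mem_Iio.mp hj).not_gt
  · exact prod_congr rfl fun j hj => if_pos (mem_Ioi.mp hj)

end Pairs

section Alternants

variable {A : Type*} [CommRing A] [Algebra ℤ A] {n N : ℕ}

theorem map_aeval_int {B : Type*} [CommRing B] [Algebra ℤ B] (f : A →+* B) (y : Fin N → A)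
    (p : MvPolynomial (Fin N) ℤ) :
    f (MvPolynomial.aeval y p) = MvPolynomial.aeval (f ∘ y) p := by
  induction p using MvPolynomial.induction_on with
  | C r => simp
  | add p r hp hr => simp [hp, hr]
  | mul_X p i hp => simp [hp]

theorem aeval_alternant (y : Fin N → A) (lam : Fin N → ℕ) :
    MvPolynomial.aeval y (alternant lam) =
      (Matrix.of fun i j : Fin N => y i ^ (lam j + (N - 1 - (j : ℕ)))).det := by
  rw [alternant, AlgHom.map_det]
  congr 1
  ext i j
  simp

theorem aeval_vandermondeProd (y : Fin N → A) :
    MvPolynomial.aeval y (vandermondeProd N) = ∏ p ∈ pairs N, (y p.1 - y p.2) := by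
  simp [vandermondeProd, map_prod]

theorem vandermondeProd_eq_alternant_zero (N : ℕ) : vandermondeProd N = alternant 0 := by
  have hmatrix : Matrix.projVandermonde 1 MvPolynomial.X =
      Matrix.of fun i j : Fin N =>
        (MvPolynomial.X i : MvPolynomial (Fin N) ℤ) ^ (0 + (N - 1 - (j : ℕ))) := by
    ext1 i j
    rw [Matrix.projVandermonde_apply, Pi.one_apply, one_pow, one_mul, Matrix.of_apply, Fin.val_rev,
      zero_add, Nat.sub_sub, add_comm 1]
  have hdet := Matrix.det_projVandermonde (1 : Fin N → MvPolynomial (Fin N) ℤ) MvPolynomial.X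
  rw [hmatrix] at hdet
  refine Eq.trans ?_ hdet.symm
  simp [vandermondeProd, prod_pairs_eq_prod_ite N fun i j =>
    (MvPolynomial.X i - MvPolynomial.X j : MvPolynomial (Fin N) ℤ), ← prod_filter,
    filter_lt_eq_Ioi]

theorem rename_alternant (e : Equiv.Perm (Fin N)) (lam : Fin N → ℕ) :
    MvPolynomial.rename e (alternant lam) =
      ((Equiv.Perm.sign e : ℤ) : MvPolynomial (Fin N) ℤ) * alternant lam := by
  rw [alternant, ← Matrix.det_permute, AlgHom.map_det]
  congr 1
  ext1 i j
  simp

theorem aeval_vandermondeProd_ne_zero [IsDomain A] {y : Fin N → A} (hy : Function.Injective y) :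
    MvPolynomial.aeval y (vandermondeProd N) ≠ 0 := by
  rw [aeval_vandermondeProd]
  exact prod_ne_zero_iff.mpr fun p hp => sub_ne_zero.mpr (hy.ne (mem_filter.mp hp).2.ne)

theorem vandermondeProd_ne_zero (N : ℕ) : vandermondeProd N ≠ 0 := by
  simpa only [MvPolynomial.aeval_X_left_apply] using
    aeval_vandermondeProd_ne_zero (MvPolynomial.X_injective (σ := Fin N) (R := ℤ))

theorem isSymmetric_schur (lam : Fin N → ℕ) : (schur lam).IsSymmetric := by
  intro e
  have hV : MvPolynomial.rename e (vandermondeProd N) ≠ 0 :=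
    (map_ne_zero_iff _ (MvPolynomial.rename_injective e e.injective)).mpr
      (vandermondeProd_ne_zero N)
  apply mul_right_cancel₀ hV
  rw [← map_mul, schur_mul_vandermondeProd, rename_alternant, ← schur_mul_vandermondeProd,
    vandermondeProd_eq_alternant_zero, rename_alternant]
  ring

theorem aeval_snoc_zero_alternant (hn : n ≤ N) (lam : Fin n → ℕ) (y : Fin N → A) :
    MvPolynomial.aeval (Fin.snoc y 0 : Fin (N + 1) → A) (alternant (pad (N + 1) lam)) =
      (∏ i, y i) * MvPolynomial.aeval y (alternant (pad N lam)) := by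
  have hlast : pad (N + 1) lam (Fin.last N) = 0 := by simp [pad, hn]
  have hcast (j : Fin N) : pad (N + 1) lam j.castSucc = pad N lam j := by simp [pad]
  rw [aeval_alternant, aeval_alternant, Matrix.det_succ_row _ (Fin.last N), Fin.sum_univ_castSucc,
    sum_eq_zero, zero_add, ← Matrix.det_mul_column]
  · simp only [Matrix.of_apply, Fin.snoc_last, Fin.val_last, Fin.succAbove_last, hlast,
      add_tsub_cancel_right, tsub_self, add_zero, pow_zero, mul_one, Even.neg_one_pow ⟨N, rfl⟩,
      one_mul]
    congr 1
    ext1 i j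
    have hj := j.isLt
    simp only [Matrix.submatrix_apply, Matrix.of_apply, Fin.snoc_castSucc, Fin.val_castSucc, hcast,
      ← pow_succ']
    congr 1
    omega
  · intro j _
    have hj := j.isLt
    simp only [Matrix.of_apply, Fin.snoc_last, Fin.val_castSucc]
    rw [zero_pow (by omega)]
    simp

theorem aeval_snoc_zero_schur (hn : n ≤ N) (lam : Fin n → ℕ) (y : Fin N → A) :
    MvPolynomial.aeval (Fin.snoc y 0 : Fin (N + 1) → A) (schur (pad (N + 1) lam)) =
      MvPolynomial.aeval y (schur (pad N lam)) := by
  have huniv : MvPolynomial.aeval (Fin.snoc MvPolynomial.X 0) (schur (pad (N + 1) lam)) =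
      schur (pad N lam) := by
    have hX : ∏ i : Fin N, (MvPolynomial.X i : MvPolynomial (Fin N) ℤ) ≠ 0 :=
      prod_ne_zero_iff.mpr fun i _ => MvPolynomial.X_ne_zero i
    have hpad (M : ℕ) : (0 : Fin M → ℕ) = pad M (0 : Fin n → ℕ) := by
      ext
      simp [pad]
    apply mul_right_cancel₀ (mul_ne_zero hX (vandermondeProd_ne_zero N))
    calc _ = MvPolynomial.aeval (Fin.snoc MvPolynomial.X 0)
          (schur (pad (N + 1) lam) * vandermondeProd (N + 1)) := by
          rw [map_mul, vandermondeProd_eq_alternant_zero, vandermondeProd_eq_alternant_zero,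
            hpad N, hpad (N + 1), aeval_snoc_zero_alternant hn, MvPolynomial.aeval_X_left_apply]
      _ = _ := by
          rw [schur_mul_vandermondeProd, aeval_snoc_zero_alternant hn,
            MvPolynomial.aeval_X_left_apply, ← schur_mul_vandermondeProd, mul_left_comm]
  rw [← huniv, MvPolynomial.comp_aeval_apply]
  congr 2
  ext i
  refine Fin.lastCases ?_ (fun i => ?_) i <;> simp

theorem aeval_append_zero_schur {m : ℕ} (hn : n ≤ m) (lam : Fin n → ℕ) (y : Fin m → A) (d : ℕ) :
    MvPolynomial.aeval (Fin.append y (0 : Fin d → A)) (schur (pad (m + d) lam)) =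
      MvPolynomial.aeval y (schur (pad m lam)) := by
  induction d with
  | zero => rw [Fin.append_right_nil _ _ rfl]; rfl
  | succ d ih =>
    have hsnoc : (0 : Fin (d + 1) → A) = Fin.snoc (0 : Fin d → A) 0 := by
      ext i
      refine Fin.lastCases ?_ (fun i => ?_) i <;> simp
    rw [hsnoc, Fin.append_snoc, ← ih]
    exact aeval_snoc_zero_schur (hn.trans (Nat.le_add_right m d)) lam _

theorem aeval_vandermondeProd_succ (y : Fin (N + 1) → A) (l : Fin (N + 1)) :
    MvPolynomial.aeval y (vandermondeProd (N + 1)) =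
      (-1) ^ (l : ℕ) * (∏ m, (y l - y (l.succAbove m))) *
        MvPolynomial.aeval (y ∘ l.succAbove) (vandermondeProd N) := by
  rw [aeval_vandermondeProd, aeval_vandermondeProd, prod_pairs_succ l fun i j => y i - y j]
  congr 1
  have hsign : (-1 : A) ^ (l : ℕ) = ∏ m : Fin N, if l < l.succAbove m then 1 else -1 := by
    simpa using (prod_ite_lt_succAbove l (fun _ => (1 : A)) fun _ => -1).symm
  rw [hsign, ← prod_mul_distrib]
  refine prod_congr rfl fun m _ => ?_
  split_ifs <;> ring

theorem aeval_alternant_pad_succ (y : Fin (N + 1) → A) (lam : Fin (n + 1) → ℕ) :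
    MvPolynomial.aeval y (alternant (pad (N + 1) lam)) =
      ∑ l : Fin (N + 1), (-1) ^ (l : ℕ) * y l ^ (lam 0 + N) *
        MvPolynomial.aeval (y ∘ l.succAbove) (alternant (pad N (lam ∘ Fin.succ))) := by
  rw [aeval_alternant, Matrix.det_succ_column_zero]
  refine sum_congr rfl fun l _ => ?_
  rw [aeval_alternant]
  congr 2
  ext1 i j
  simp only [Matrix.submatrix_apply, Matrix.of_apply, Function.comp_apply, Fin.val_succ]
  congr 2
  · simp only [pad, Fin.val_succ, Nat.add_lt_add_iff_right]
    rfl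
  · omega

theorem mul_aeval_schur_pad_succ [IsDomain A] (lam : Fin (n + 1) → ℕ) {y : Fin (N + 1) → A}
    (hy : Function.Injective y) (P : A) (B : Fin (N + 1) → A)
    (hB : ∀ l, B l * ∏ m, (y l - y (l.succAbove m)) = P * y l ^ N) :
    P * MvPolynomial.aeval y (schur (pad (N + 1) lam)) =
      ∑ l, y l ^ lam 0 * B l *
        MvPolynomial.aeval (y ∘ l.succAbove) (schur (pad N (lam ∘ Fin.succ))) := by
  apply mul_right_cancel₀ (aeval_vandermondeProd_ne_zero hy)
  rw [mul_assoc, ← map_mul, schur_mul_vandermondeProd, aeval_alternant_pad_succ, mul_sum, sum_mul]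
  refine sum_congr rfl fun l _ => ?_
  rw [← schur_mul_vandermondeProd, map_mul, aeval_vandermondeProd_succ y l, pow_add]
  set S := MvPolynomial.aeval (y ∘ l.succAbove) (schur (pad N (lam ∘ Fin.succ)))
  set V := MvPolynomial.aeval (y ∘ l.succAbove) (vandermondeProd N)
  linear_combination (-(-1) ^ (l : ℕ) * y l ^ lam 0 * S * V) * hB l

end Alternants

section SchurEval

variable {A ι : Type*} [CommRing A] [Fintype ι] {n : ℕ}

/-- The Schur polynomial of shape `lam` evaluated at a finite family. The family is enumerated by
`Fintype.equivFin`; since Schur polynomials are symmetric, the choice of the enumeration is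
immaterial (`schurEval_eq_aeval`). -/
def schurEval (lam : Fin n → ℕ) (z : ι → A) : A :=
  MvPolynomial.aeval (z ∘ (Fintype.equivFin ι).symm) (schur (pad (Fintype.card ι) lam))

theorem schurEval_eq_aeval {N : ℕ} (lam : Fin n → ℕ) (z : ι → A) (e : Fin N ≃ ι) :
    schurEval lam z = MvPolynomial.aeval (z ∘ e) (schur (pad N lam)) := by
  obtain rfl : N = Fintype.card ι := by simpa using Fintype.card_congr e
  conv_rhs => rw [← isSymmetric_schur _ ((Fintype.equivFin ι).symm.trans e.symm),
    MvPolynomial.aeval_rename]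
  simp only [schurEval, Function.comp_def, Equiv.trans_apply, Equiv.apply_symm_apply]

theorem schurEval_of_isEmpty [IsEmpty ι] (lam : Fin n → ℕ) (z : ι → A) : schurEval lam z = 1 := by
  have hschur : schur (pad 0 lam) = 1 := by
    simpa [vandermondeProd, alternant, pairs] using schur_mul_vandermondeProd (pad 0 lam)
  rw [schurEval_eq_aeval lam z (Equiv.equivOfIsEmpty (Fin 0) ι), hschur, map_one]

theorem map_schurEval {B : Type*} [CommRing B] (f : A →+* B) (lam : Fin n → ℕ) (z : ι → A) :
    f (schurEval lam z) = schurEval lam (f ∘ z) :=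
  map_aeval_int f _ _

theorem schurEval_of_eq_zero {κ : Type*} [Fintype κ] (lam : Fin n → ℕ) (z : ι → A) (f : κ ↪ ι)
    (hf : ∀ i, i ∉ Set.range f → z i = 0) (hn : n ≤ Fintype.card κ) :
    schurEval lam z = schurEval lam (z ∘ f) := by
  classical
  let rest := Fintype.equivFin {i // i ∉ Set.range f}
  let split : κ ⊕ {i // i ∉ Set.range f} ≃ ι :=
    ((Equiv.ofInjective f f.injective).sumCongr (Equiv.refl _)).trans
      (Equiv.sumCompl (· ∈ Set.range f))
  let e := (finSumFinEquiv.symm.trans ((Fintype.equivFin κ).symm.sumCongr rest.symm)).trans split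
  have he : z ∘ e = Fin.append ((z ∘ f) ∘ (Fintype.equivFin κ).symm) 0 := by
    ext i
    refine Fin.addCases (fun i => ?_) (fun i => ?_) i
    · simp [e, split]
    · simpa [e, split] using hf _ (rest.symm i).2
  rw [schurEval_eq_aeval lam z e, he, aeval_append_zero_schur hn, schurEval]

theorem mul_schurEval_eq_sum [IsDomain A] [DecidableEq ι] [Nonempty ι] (lam : Fin (n + 1) → ℕ)
    {z : ι → A} (hz : Function.Injective z) (P : A) (B : ι → A)
    (hB : ∀ l, B l * ∏ m ∈ univ.erase l, (z l - z m) = P * z l ^ (Fintype.card ι - 1)) :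
    P * schurEval lam z =
      ∑ l, z l ^ lam 0 * B l * schurEval (lam ∘ Fin.succ) (fun m : {m // m ≠ l} => z m) := by
  obtain ⟨N, hN⟩ : ∃ N, Fintype.card ι = N + 1 :=
    Nat.exists_eq_succ_of_ne_zero Fintype.card_ne_zero
  let e : Fin (N + 1) ≃ ι := (finCongr hN.symm).trans (Fintype.equivFin ι).symm
  let s (l : Fin (N + 1)) : Fin N ≃ {m // m ≠ e l} :=
    (finSuccAboveEquiv l).trans (e.subtypeEquiv fun a => by simp)
  rw [schurEval_eq_aeval lam z e, mul_aeval_schur_pad_succ lam (hz.comp e.injective) P (B ∘ e),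
    ← e.sum_comp]
  · refine sum_congr rfl fun l _ => ?_
    rw [schurEval_eq_aeval (lam ∘ Fin.succ) _ (s l)]
    rfl
  · intro l
    have hBl := hB (e l)
    rw [prod_subtype (p := (· ≠ e l)) _ (by simp), ← (s l).prod_comp, hN] at hBl
    exact hBl

end SchurEval

section DividedDifferences

variable {F ι : Type*} [Field F] [DecidableEq ι]

theorem sum_sub_mul_nodalWeight {s : Finset ι} {v : ι → F} (hv : Set.InjOn v s) {b : ι}
    (hb : b ∈ s) (f : ι → F) :
    ∑ i ∈ s, (v i - v b) * (Lagrange.nodalWeight s v i * f i) =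
      ∑ i ∈ s.erase b, Lagrange.nodalWeight (s.erase b) v i * f i := by
  rw [← add_sum_erase _ _ hb, sub_self, zero_mul, zero_add]
  refine sum_congr rfl fun i hi => ?_
  obtain ⟨hib, his⟩ := mem_erase.mp hi
  have hne : v i - v b ≠ 0 := sub_ne_zero.mpr (hv.ne his hb hib)
  rw [Lagrange.nodalWeight, ← mul_prod_erase _ _ (mem_erase.mpr ⟨hib.symm, hb⟩), erase_right_comm,
    ← Lagrange.nodalWeight, mul_assoc, mul_inv_cancel_left₀ hne]

theorem nodalWeight_map {κ : Type*} [DecidableEq κ] (e : κ ↪ ι) (s : Finset κ) (v : ι → F)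
    (i : κ) : Lagrange.nodalWeight (s.map e) v (e i) = Lagrange.nodalWeight s (v ∘ e) i := by
  simp [Lagrange.nodalWeight, ← map_erase]

theorem nodalWeight_const_mul (c : F) {s : Finset ι} (v : ι → F) {i : ι} (hi : i ∈ s) :
    Lagrange.nodalWeight s (fun j => c * v j) i =
      (c ^ (#s - 1))⁻¹ * Lagrange.nodalWeight s v i := by
  simp [Lagrange.nodalWeight, ← mul_sub, prod_mul_distrib, card_erase_of_mem hi, mul_comm]

end DividedDifferences

section QIdentities

theorem q_ne_zero : q ≠ 0 := RatFunc.X_ne_zero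

theorem q_pow_injective : Function.Injective fun m : ℕ => q ^ m := by
  intro m k h
  have hX : (Polynomial.X ^ m : Polynomial ℚ) = Polynomial.X ^ k :=
    RatFunc.algebraMap_injective ℚ (by simpa [q, RatFunc.algebraMap_X] using h)
  simpa using congrArg Polynomial.natDegree hX

theorem one_sub_q_pow_ne_zero {m : ℕ} (hm : 0 < m) : 1 - q ^ m ≠ 0 := fun h =>
  hm.ne (q_pow_injective ((pow_zero q).trans (sub_eq_zero.mp h)))

theorem qPoch_q_succ (n : ℕ) : qPoch q (n + 1) = qPoch q n * (1 - q ^ (n + 1)) := by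
  simp [qPoch, prod_range_succ, pow_succ']

theorem qPoch_q_ne_zero (n : ℕ) : qPoch q n ≠ 0 :=
  prod_ne_zero_iff.mpr fun i _ => by
    simpa [← pow_succ'] using one_sub_q_pow_ne_zero i.succ_pos

theorem qbin_zero_right (n : ℕ) : qbin n 0 = 1 := by
  have h := div_self (qPoch_q_ne_zero n)
  simpa [qbin, qPoch] using h

theorem one_sub_mul_qbin_succ {r m : ℕ} (h : m + 1 ≤ r) :
    (1 - q ^ (m + 1)) * qbin r (m + 1) = (1 - q ^ (r - m)) * qbin r m := by
  obtain ⟨d, rfl⟩ := Nat.exists_eq_add_of_le h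
  have hm := qPoch_q_ne_zero m
  have hd := qPoch_q_ne_zero d
  have hm' := one_sub_q_pow_ne_zero m.succ_pos
  have hd' := one_sub_q_pow_ne_zero d.succ_pos
  rw [qbin, qbin, if_pos h, if_pos (by omega), show m + 1 + d - (m + 1) = d by omega,
    show m + 1 + d - m = d + 1 by omega, qPoch_q_succ m, qPoch_q_succ d]
  field_simp

theorem sum_nodalWeight_q_pow_erase_zero {m r : ℕ} (h : m ≤ r) :
    ∑ k ∈ (range (m + 2)).erase 0,
        Lagrange.nodalWeight ((range (m + 2)).erase 0) (q ^ ·) k * (q ^ k) ^ r =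
      q ^ (r - m) *
        ∑ k ∈ range (m + 1), Lagrange.nodalWeight (range (m + 1)) (q ^ ·) k * (q ^ k) ^ r := by
  have herase : (range (m + 2)).erase 0 = (range (m + 1)).map ⟨(· + 1), add_left_injective 1⟩ := by
    ext (_ | k) <;> simp
  rw [herase, sum_map, mul_sum]
  refine sum_congr rfl fun k hk => ?_
  have hweight := nodalWeight_const_mul q (q ^ ·) hk
  rw [card_range, Nat.add_sub_cancel] at hweight
  rw [nodalWeight_map, pow_sub₀ _ q_ne_zero h]
  simp only [Function.comp_def, Function.Embedding.coeFn_mk, pow_succ', hweight, mul_pow]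
  ring

theorem sum_nodalWeight_q_pow {m r : ℕ} (h : m ≤ r) :
    ∑ k ∈ range (m + 1), Lagrange.nodalWeight (range (m + 1)) (q ^ ·) k * (q ^ k) ^ r =
      qbin r m := by
  induction m with
  | zero => simp [qbin_zero_right, Lagrange.nodalWeight]
  | succ m ih =>
    have hinj : Set.InjOn (q ^ ·) (range (m + 2) : Set ℕ) := q_pow_injective.injOn
    have hlast := sum_sub_mul_nodalWeight hinj (mem_coe.mpr (self_mem_range_succ (m + 1)))
      fun k => (q ^ k) ^ r
    have hfirst := sum_sub_mul_nodalWeight hinj (mem_coe.mpr (mem_range.mpr (m + 1).succ_pos))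
      fun k => (q ^ k) ^ r
    have herase : (range (m + 2)).erase (m + 1) = range (m + 1) := by
      rw [range_add_one, erase_insert notMem_range_self]
    rw [herase, ih (by omega)] at hlast
    rw [sum_nodalWeight_q_pow_erase_zero (by omega), ih (by omega)] at hfirst
    apply mul_left_cancel₀ (one_sub_q_pow_ne_zero m.add_one_pos)
    rw [one_sub_mul_qbin_succ h, sub_mul, sub_mul, one_mul, one_mul, ← hfirst, ← hlast, mul_sum,
      ← sum_sub_distrib, ← sum_sub_distrib]
    exact sum_congr rfl fun k _ => by ring

theorem sum_fin_nodalWeight_q_pow {m r : ℕ} (hm : 0 < m) (h : m ≤ r + 1) :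
    ∑ k : Fin m, Lagrange.nodalWeight univ (fun l : Fin m => q ^ (l : ℕ)) k *
      (q ^ (k : ℕ)) ^ r = qbin r (m - 1) := by
  have hrange : (univ : Finset (Fin m)).map Fin.valEmbedding = range m := by
    simp [Nat.Iio_eq_range]
  rw [← sum_nodalWeight_q_pow (Nat.sub_le_of_le_add h), Nat.sub_add_cancel hm, ← hrange, sum_map]
  exact sum_congr rfl fun k _ => by rw [nodalWeight_map]; rfl

-- In the next three lemmas `(δ, ε)`, equal to `(0, 1)` or `(1, 0)`, records which of the two
-- `q`-shifted factorials of a pair of variables carries the extra factor `q`.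
open Polynomial in
theorem prod_dvd_dysonPair {a b k δ ε : ℕ} (hk : k < a) (h : δ + ε = 1) :
    ∏ l ∈ range b, (C (q ^ k) * X - C (q ^ l)) ∣
      (∏ m ∈ range a, (1 - C (q ^ (δ + m)) * X)) * ∏ l ∈ range b, (X - C (q ^ (ε + l))) := by
  have hqk : q ^ k ≠ 0 := pow_ne_zero _ q_ne_zero
  have hunit : IsUnit (C (q ^ k) : K[X]) := isUnit_C.mpr hqk.isUnit
  have hfactor (l : ℕ) : C (q ^ k) * X - C (q ^ l) = C (q ^ k) * (X - C (q ^ l / q ^ k)) := by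
    rw [mul_sub, ← C_mul, mul_div_cancel₀ _ hqk]
  refine prod_dvd_of_coprime (fun l _ m _ hlm => ?_) fun l hl => ?_
  · simp only [Function.onFun, hfactor, isCoprime_mul_unit_left hunit]
    exact pairwise_coprime_X_sub_C (s := fun l => q ^ l / q ^ k)
      (fun l m h => q_pow_injective ((div_left_inj' hqk).mp h)) hlm
  rw [hfactor, hunit.mul_left_dvd, dvd_iff_isRoot, IsRoot, eval_mul, eval_prod, eval_prod,
    mul_eq_zero]
  rcases lt_or_ge l (k + ε) with hlk | hlk
  · left
    refine prod_eq_zero (i := k + ε - 1 - l) (mem_range.mpr (by omega)) ?_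
    simp only [eval_sub, eval_one, eval_mul, eval_C, eval_X]
    rw [mul_div_assoc', ← pow_add, show δ + (k + ε - 1 - l) + l = k by omega, div_self hqk,
      sub_self]
  · right
    have hl := mem_range.mp hl
    refine prod_eq_zero (i := l - (k + ε)) (mem_range.mpr (by omega)) ?_
    simp only [eval_sub, eval_C, eval_X]
    rw [sub_eq_zero, div_eq_iff hqk, ← pow_add, show ε + (l - (k + ε)) + k = l by omega]

open Polynomial in
theorem exists_dysonPair_quotient {a b k δ ε : ℕ} (hk : k < a) (h : δ + ε = 1) :
    ∃ f : K[X], f * ∏ l ∈ range b, (C (q ^ k) * X - C (q ^ l)) =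
        (∏ m ∈ range a, (1 - C (q ^ (δ + m)) * X)) * ∏ l ∈ range b, (X - C (q ^ (ε + l))) ∧
      f.coeff 0 = q ^ (ε * b) := by
  obtain ⟨f, hf⟩ := prod_dvd_dysonPair (b := b) hk h
  refine ⟨f, by rw [hf, mul_comm], ?_⟩
  have hne : ∏ l ∈ range b, -(q ^ l) ≠ 0 :=
    prod_ne_zero_iff.mpr fun l _ => neg_ne_zero.mpr (pow_ne_zero _ q_ne_zero)
  apply mul_left_cancel₀ hne
  have heval := congrArg (eval 0) hf
  simp only [eval_mul, eval_prod, eval_sub, eval_C, eval_X, eval_one, mul_zero, sub_zero, zero_sub,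
    prod_const_one, one_mul, pow_add, ← mul_neg, prod_mul_distrib, prod_const, card_range] at heval
  rw [coeff_zero_eq_eval_zero, ← heval, pow_mul, mul_comm]

open Polynomial in
theorem aeval_mul_prod_sub {A : Type} [CommRing A] [Algebra K A] {a b k δ ε : ℕ} {f : K[X]}
    (hf : f * ∏ l ∈ range b, (C (q ^ k) * X - C (q ^ l)) =
      (∏ m ∈ range a, (1 - C (q ^ (δ + m)) * X)) * ∏ l ∈ range b, (X - C (q ^ (ε + l))))
    {x y u u' : A} (hu : y * u = x) (hu' : x * u' = y) :
    aeval u f * ∏ l ∈ range b, (x * algebraMap K A (q ^ k) - y * algebraMap K A (q ^ l)) =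
      x ^ b * (qPoch (algebraMap K A (q ^ δ) * u) a * qPoch (algebraMap K A (q ^ ε) * u') b) := by
  have haeval := congrArg (aeval u) hf
  simp only [map_mul, map_prod, map_sub, map_one, aeval_C, aeval_X] at haeval
  have hpow (z : A) (g : ℕ → A) : ∏ l ∈ range b, z * g l = z ^ b * ∏ l ∈ range b, g l := by
    simp [prod_mul_distrib]
  have hdenom : ∏ l ∈ range b, (x * algebraMap K A (q ^ k) - y * algebraMap K A (q ^ l)) =
      y ^ b * ∏ l ∈ range b, (algebraMap K A (q ^ k) * u - algebraMap K A (q ^ l)) := by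
    rw [← hpow]
    exact prod_congr rfl fun l _ => by rw [← hu]; ring
  have hnum : y ^ b * ∏ l ∈ range b, (u - algebraMap K A (q ^ (ε + l))) =
      x ^ b * qPoch (algebraMap K A (q ^ ε) * u') b := by
    rw [qPoch, ← hpow, ← hpow]
    refine prod_congr rfl fun l _ => ?_
    rw [pow_add, map_mul]
    linear_combination hu + algebraMap K A (q ^ ε) * algebraMap K A (q ^ l) * hu'
  have hfirst : ∏ m ∈ range a, (1 - algebraMap K A (q ^ (δ + m)) * u) =
      qPoch (algebraMap K A (q ^ δ) * u) a :=
    prod_congr rfl fun m _ => by rw [pow_add, map_mul, mul_right_comm]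
  rw [hdenom, mul_left_comm, haeval, mul_left_comm, hnum, hfirst, mul_left_comm]

end QIdentities

section LaurentPolynomials

variable {n : ℕ}

theorem mono_add (u v : Fin n → ℤ) : mono (u + v) = mono u * mono v := by
  simp [mono, AddMonoidAlgebra.single_mul_single]

theorem mono_pow (u : Fin n → ℤ) (r : ℕ) : mono u ^ r = mono (r • u) := by
  simp [mono, AddMonoidAlgebra.single_pow]

theorem mono_mul_single (u v : Fin n → ℤ) (c : K) :
    mono u * AddMonoidAlgebra.single v c = AddMonoidAlgebra.single (u + v) c := by
  simp [mono, AddMonoidAlgebra.single_mul_single]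

/-- The variable `x_i` as a Laurent polynomial. -/
def var (i : Fin n) : Laurent n := mono (Pi.single i 1)

theorem var_mul_ratio (i j : Fin n) : var j * ratio i j = var i := by
  rw [ratio, var, var, ← mono_add, add_sub_cancel]

/-- The inclusion of the Laurent polynomials in the variables other than `x_i`. -/
def embed (i : Fin (n + 1)) : Laurent n →ₐ[K] Laurent (n + 1) :=
  AddMonoidAlgebra.mapDomainAlgHom K K <|
    AddMonoidHom.mk' (fun u : Fin n → ℤ => (i.insertNth 0 u : Fin (n + 1) → ℤ)) fun u v => by
      rw [Fin.insertNth_eq_iff]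
      simp [funext_iff, Fin.removeNth]

theorem embed_single (i : Fin (n + 1)) (u : Fin n → ℤ) (c : K) :
    embed i (AddMonoidAlgebra.single u c) =
      AddMonoidAlgebra.single (i.insertNth 0 u : Fin (n + 1) → ℤ) c := by
  simp [embed]

theorem embed_ratio (i : Fin (n + 1)) (j k : Fin n) :
    embed i (ratio j k) = ratio (i.succAbove j) (i.succAbove k) := by
  rw [ratio, mono, embed_single, ratio, mono]
  congr 1
  rw [Fin.insertNth_eq_iff]
  simp [funext_iff, Fin.removeNth, Pi.single_apply, (i.succAbove_ne _).symm]

/-- The evaluation, at `X = x_i`, of polynomials whose coefficients are Laurent polynomials in the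
other variables. -/
def polyEmbed (i : Fin (n + 1)) : Polynomial (Laurent n) →ₐ[K] Laurent (n + 1) :=
  Polynomial.eval₂AlgHom (embed i) (var i) fun _ => Commute.all _ _

@[simp]
theorem polyEmbed_C (i : Fin (n + 1)) (g : Laurent n) :
    polyEmbed i (Polynomial.C g) = embed i g := Polynomial.eval₂_C _ _

@[simp]
theorem polyEmbed_X (i : Fin (n + 1)) : polyEmbed i Polynomial.X = var i :=
  Polynomial.eval₂_X _ _

theorem polyEmbed_monomial_single (i : Fin (n + 1)) (t : ℕ) (u : Fin n → ℤ) (c : K) :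
    polyEmbed i (Polynomial.monomial t (AddMonoidAlgebra.single u c)) =
      AddMonoidAlgebra.single (i.insertNth (t : ℤ) u : Fin (n + 1) → ℤ) c := by
  rw [← Polynomial.C_mul_X_pow_eq_monomial, map_mul, map_pow, polyEmbed_C, polyEmbed_X,
    embed_single, var, mono_pow, mul_comm, mono_mul_single]
  congr 1
  rw [Fin.eq_insertNth_iff]
  simp [funext_iff, Fin.removeNth]

theorem CT_add (f g : Laurent n) : CT (f + g) = CT f + CT g := by simp [CT]

theorem CT_sum {ι : Type*} (s : Finset ι) (f : ι → Laurent n) :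
    CT (∑ i ∈ s, f i) = ∑ i ∈ s, CT (f i) := by simp [CT]

theorem CT_algebraMap_mul (c : K) (f : Laurent n) :
    CT (algebraMap K (Laurent n) c * f) = c * CT f := by
  simp [CT]

theorem CT_single (u : Fin n → ℤ) (c : K) :
    CT (AddMonoidAlgebra.single u c : Laurent n) = if u = 0 then c else 0 := by
  simp [CT, Finsupp.single_apply]

theorem CT_mono_mul_polyEmbed (i : Fin (n + 1)) (v : Fin (n + 1) → ℕ)
    (p : Polynomial (Laurent n)) :
    CT (mono (fun j => -(v j : ℤ)) * polyEmbed i p) =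
      CT (mono (fun j => -(v (i.succAbove j) : ℤ)) * p.coeff (v i)) := by
  induction p using Polynomial.induction_on' with
  | add p g hp hg => simp only [map_add, Polynomial.coeff_add, mul_add, CT_add, hp, hg]
  | monomial t g =>
    induction g using AddMonoidAlgebra.induction_linear with
    | zero => simp [CT]
    | add g h hg hh => simp only [map_add, Polynomial.coeff_add, mul_add, CT_add, hg, hh]
    | single u c =>
      rw [polyEmbed_monomial_single, mono_mul_single, CT_single, Polynomial.coeff_monomial]
      simp only [add_eq_zero_iff_eq_neg', Fin.insertNth_eq_iff]
      by_cases ht : t = v i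
      · simp [ht, mono_mul_single, CT_single, add_eq_zero_iff_eq_neg', funext_iff, Fin.removeNth]
      · simp [ht, CT]

end LaurentPolynomials

section Alphabets

variable {n : ℕ}

/-- The alphabet `(x_i q ^ k)`, indexed by the pairs `(i, k)` with `k < a_i`. In contrast to
`alphabet`, the variables `x_i` may be specialized to elements of any algebra. -/
def qAlphabet {A : Type*} [CommRing A] [Algebra K A] (x : Fin n → A) (a : Fin n → ℕ)
    (s : Σ i, Fin (a i)) : A :=
  x s.1 * algebraMap K A (q ^ (s.2 : ℕ))

theorem qAlphabet_var_injective (a : Fin n → ℕ) : Function.Injective (qAlphabet var a) := by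
  have hsingle (s : Σ i, Fin (a i)) : qAlphabet var a s =
      AddMonoidAlgebra.single (Pi.single s.1 1) (q ^ (s.2 : ℕ)) := by
    simp [qAlphabet, var, mono, AddMonoidAlgebra.coe_algebraMap,
      AddMonoidAlgebra.single_mul_single]
  rintro ⟨i, k⟩ ⟨j, l⟩ h
  rw [hsingle, hsingle, AddMonoidAlgebra.single_inj] at h
  rcases h with ⟨hexp, hcoeff⟩ | ⟨hcoeff, -⟩
  · obtain rfl : i = j := by
      by_contra hij
      simpa [hij] using congrFun hexp i
    obtain rfl : k = l := Fin.ext (q_pow_injective hcoeff)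
    rfl
  · exact absurd hcoeff (pow_ne_zero _ q_ne_zero)

/-- The variables `x_1, …, x_{n+1}`, regarded as polynomials in `x_i`. -/
def polyVar (i : Fin (n + 1)) : Fin (n + 1) → Polynomial (Laurent n) :=
  i.insertNth (α := fun _ => Polynomial (Laurent n)) Polynomial.X fun j => Polynomial.C (var j)

theorem polyEmbed_polyVar (i j : Fin (n + 1)) : polyEmbed i (polyVar i j) = var j := by
  refine Fin.succAboveCases i ?_ (fun j => ?_) j
  · rw [polyVar, Fin.insertNth_apply_same, polyEmbed_X]
  · rw [polyVar, Fin.insertNth_apply_succAbove, polyEmbed_C, var, mono, embed_single, var, mono]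
    congr 1
    rw [Fin.insertNth_eq_iff]
    simp [funext_iff, Fin.removeNth, Pi.single_apply, (i.succAbove_ne _).symm]

theorem polyEmbed_qAlphabet (i : Fin (n + 1)) (a : Fin (n + 1) → ℕ) (s : Σ i, Fin (a i)) :
    polyEmbed i (qAlphabet (polyVar i) a s) = qAlphabet var a s := by
  rw [qAlphabet, map_mul, polyEmbed_polyVar, AlgHom.commutes, qAlphabet]

theorem constantCoeff_qAlphabet_self (i : Fin (n + 1)) (a : Fin (n + 1) → ℕ) (k : Fin (a i)) :
    Polynomial.constantCoeff (qAlphabet (polyVar i) a ⟨i, k⟩) = 0 := by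
  simp [qAlphabet, polyVar]

theorem constantCoeff_qAlphabet_succAbove (i : Fin (n + 1)) (a : Fin (n + 1) → ℕ) (j : Fin n)
    (k : Fin (a (i.succAbove j))) :
    Polynomial.constantCoeff (qAlphabet (polyVar i) a ⟨i.succAbove j, k⟩) =
      qAlphabet var (a ∘ i.succAbove) ⟨j, k⟩ := by
  simp [qAlphabet, polyVar]

theorem constantCoeff_schurEval {m : ℕ} (i : Fin (n + 1)) (a : Fin (n + 1) → ℕ)
    (hm : m ≤ ∑ j, a (i.succAbove j)) (lam : Fin m → ℕ) (k : Fin (a i)) :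
    Polynomial.constantCoeff (schurEval lam
        fun s : {s : Σ i, Fin (a i) // s ≠ ⟨i, k⟩} => qAlphabet (polyVar i) a s) =
      schurEval lam (qAlphabet var (a ∘ i.succAbove)) := by
  let f : (Σ j, Fin ((a ∘ i.succAbove) j)) ↪ {s : Σ i, Fin (a i) // s ≠ ⟨i, k⟩} :=
    ⟨fun s => ⟨⟨i.succAbove s.1, s.2⟩, fun h => i.succAbove_ne s.1 (congrArg Sigma.fst h)⟩, by
      rintro ⟨j, l⟩ ⟨j', l'⟩ h
      have h' := Sigma.mk.inj_iff.mp (congrArg Subtype.val h)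
      obtain rfl := i.succAbove_right_injective h'.1
      obtain rfl := eq_of_heq h'.2
      rfl⟩
  rw [map_schurEval, schurEval_of_eq_zero lam _ f]
  · congr 1
    ext1 ⟨j, l⟩
    exact constantCoeff_qAlphabet_succAbove i a j l
  · rintro ⟨⟨j, l⟩, hs⟩ hr
    revert l
    refine Fin.succAboveCases i (fun l hs _ => ?_) (fun j l hs hr => ?_) j
    · exact constantCoeff_qAlphabet_self i a l
    · exact absurd ⟨⟨j, l⟩, rfl⟩ hr
  · simpa using hm

theorem D₂_pad_eq {m : ℕ} (v a : Fin n → ℕ) (lam : Fin m → ℕ) :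
    D₂ v a (pad (∑ i, a i) lam) =
      CT (mono (fun i => -(v i : ℤ)) * (dysonProd a * schurEval lam (qAlphabet var a))) := by
  rw [schurEval_eq_aeval lam (qAlphabet var a) finSigmaFinEquiv.symm, D₂, mul_assoc,
    mul_comm (dysonProd a)]
  congr 3
  exact @map_aeval_int _ _ _ _ _ _ (Ring.toIntAlgebra _) (RingHom.id (Laurent n)) (alphabet a) _

end Alphabets

section DysonProduct

variable {n : ℕ}

theorem map_qPoch {A B : Type} [CommRing A] [CommRing B] [Algebra K A] [Algebra K B]
    (f : A →ₐ[K] B) (z : A) (k : ℕ) : f (qPoch z k) = qPoch (f z) k := by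
  simp [qPoch, map_prod]

/-- The factor of the `q`-Dyson product that belongs to the variables `x_i` and `x_j`. The factor
`q` multiplies the ratio of the later variable to the earlier one, which makes the definition
symmetric in `i` and `j` (`pairFactor_comm`). -/
def pairFactor (a : Fin n → ℕ) (i j : Fin n) : Laurent n :=
  qPoch (algebraMap K _ (q ^ if j < i then 1 else 0) * ratio i j) (a i) *
    qPoch (algebraMap K _ (q ^ if i < j then 1 else 0) * ratio j i) (a j)

theorem pairFactor_comm (a : Fin n → ℕ) (i j : Fin n) : pairFactor a i j = pairFactor a j i :=
  mul_comm _ _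

theorem dysonProd_eq_prod_pairFactor (a : Fin n → ℕ) :
    dysonProd a = ∏ p ∈ pairs n, pairFactor a p.1 p.2 := by
  refine prod_congr rfl fun p hp => ?_
  have hlt : p.1 < p.2 := (mem_filter.mp hp).2
  simp only [pairFactor, hlt, hlt.not_gt, if_true, if_false, pow_zero, pow_one, map_one, one_mul]

theorem embed_pairFactor (i : Fin (n + 1)) (a : Fin (n + 1) → ℕ) (j k : Fin n) :
    embed i (pairFactor (a ∘ i.succAbove) j k) =
      pairFactor a (i.succAbove j) (i.succAbove k) := by
  simp only [pairFactor, map_mul, map_qPoch, embed_ratio, AlgHom.commutes, Function.comp_apply,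
    Fin.succAbove_lt_succAbove_iff]

theorem dysonProd_succAbove (a : Fin (n + 1) → ℕ) (i : Fin (n + 1)) :
    dysonProd a =
      (∏ j, pairFactor a i (i.succAbove j)) * embed i (dysonProd (a ∘ i.succAbove)) := by
  simp only [dysonProd_eq_prod_pairFactor, map_prod, embed_pairFactor,
    prod_pairs_succ i (pairFactor a), pairFactor_comm a _ i, ite_self]

theorem exists_pairFactor_quotient (a : Fin (n + 1) → ℕ) (i : Fin (n + 1)) (k : Fin (a i))
    (j : Fin n) :
    ∃ F : Polynomial (Laurent n),
      polyEmbed i F *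
          ∏ l, (qAlphabet var a ⟨i, k⟩ - qAlphabet var a ⟨i.succAbove j, l⟩) =
        var i ^ a (i.succAbove j) * pairFactor a i (i.succAbove j) ∧
      Polynomial.constantCoeff F = algebraMap K _
        (q ^ if i < i.succAbove j then a (i.succAbove j) else 0) := by
  have hshift :
      (if i.succAbove j < i then 1 else 0) + (if i < i.succAbove j then 1 else 0) = 1 := by
    rcases (i.succAbove_ne j).lt_or_gt with h | h <;> simp [h, h.not_gt]
  obtain ⟨f, hf, hf0⟩ := exists_dysonPair_quotient (b := a (i.succAbove j)) k.isLt hshift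
  have hratio : polyEmbed i (Polynomial.C (mono (-Pi.single j 1)) * Polynomial.X) =
      ratio i (i.succAbove j) := by
    rw [map_mul, polyEmbed_C, polyEmbed_X, mono, embed_single, mul_comm, var, mono_mul_single,
      ratio, mono]
    congr 1
    rw [sub_eq_add_neg, add_right_inj, Fin.insertNth_eq_iff]
    simp [funext_iff, Fin.removeNth, Pi.single_apply, (i.succAbove_ne _).symm]
  refine ⟨Polynomial.aeval (Polynomial.C (mono (-Pi.single j 1)) * Polynomial.X) f, ?_, ?_⟩
  · rw [← Polynomial.aeval_algHom_apply, hratio, pairFactor,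
      ← aeval_mul_prod_sub hf (var_mul_ratio i _) (var_mul_ratio _ i),
      ← Fin.prod_univ_eq_prod_range]
    rfl
  · rw [Polynomial.aeval_def, Polynomial.hom_eval₂, map_mul, Polynomial.constantCoeff_apply,
      Polynomial.constantCoeff_apply, Polynomial.coeff_X_zero, mul_zero, Polynomial.eval₂_at_zero,
      hf0]
    simp

end DysonProduct

section Quotients

variable {n : ℕ}

theorem prod_sigma_erase {M : Type*} [CommMonoid M] {a : Fin (n + 1) → ℕ} (i : Fin (n + 1))
    (k : Fin (a i)) (f : (Σ i, Fin (a i)) → M) :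
    ∏ s ∈ univ.erase ⟨i, k⟩, f s =
      (∏ l ∈ univ.erase k, f ⟨i, l⟩) * ∏ j, ∏ l, f ⟨i.succAbove j, l⟩ := by
  rw [← filter_ne', ← filter_ne', prod_filter, prod_filter, Fintype.prod_sigma,
    Fin.prod_univ_succAbove _ i]
  congr 1
  · exact prod_congr rfl fun l _ => by simp
  · refine prod_congr rfl fun j _ => prod_congr rfl fun l _ => if_pos fun h => ?_
    exact i.succAbove_ne j (congrArg Sigma.fst h)

theorem nodalWeight_mul_prod_qAlphabet_sub (a : Fin n → ℕ) (i : Fin n) (k : Fin (a i)) :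
    algebraMap K (Laurent n) (Lagrange.nodalWeight univ (fun l : Fin (a i) => q ^ (l : ℕ)) k) *
        ∏ l ∈ univ.erase k, (qAlphabet var a ⟨i, k⟩ - qAlphabet var a ⟨i, l⟩) =
      var i ^ (a i - 1) := by
  have hne : ∏ l ∈ univ.erase k, (q ^ (k : ℕ) - q ^ (l : ℕ)) ≠ 0 :=
    prod_ne_zero_iff.mpr fun l hl =>
      sub_ne_zero.mpr (q_pow_injective.ne (Fin.val_ne_of_ne (ne_of_mem_erase hl).symm))
  simp only [qAlphabet, ← mul_sub, ← map_sub, prod_mul_distrib, prod_const, ← map_prod]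
  rw [mul_left_comm, ← map_mul, Lagrange.nodalWeight, prod_inv_distrib, inv_mul_cancel₀ hne,
    map_one, mul_one, card_erase_of_mem (mem_univ k), card_univ, Fintype.card_fin]

theorem exists_dysonProd_quotient (a : Fin (n + 1) → ℕ) (i : Fin (n + 1)) (k : Fin (a i)) :
    ∃ B : Polynomial (Laurent n),
      polyEmbed i B *
          ∏ s ∈ univ.erase (⟨i, k⟩ : Σ i, Fin (a i)), (qAlphabet var a ⟨i, k⟩ - qAlphabet var a s) =
        dysonProd a * qAlphabet var a ⟨i, k⟩ ^ (Fintype.card (Σ i, Fin (a i)) - 1) ∧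
      Polynomial.constantCoeff B = algebraMap K _
          (q ^ (∑ j ∈ Ioi i, a j) * (q ^ (k : ℕ)) ^ (∑ i, a i - 1) *
            Lagrange.nodalWeight univ (fun l : Fin (a i) => q ^ (l : ℕ)) k) *
        dysonProd (a ∘ i.succAbove) := by
  choose F hF hF0 using exists_pairFactor_quotient a i k
  have hrow := nodalWeight_mul_prod_qAlphabet_sub a i k
  set w := Lagrange.nodalWeight univ (fun l : Fin (a i) => q ^ (l : ℕ)) k
  refine ⟨algebraMap K _ ((q ^ (k : ℕ)) ^ (∑ i, a i - 1) * w) * (∏ j, F j) *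
    Polynomial.C (dysonProd (a ∘ i.succAbove)), ?_, ?_⟩
  · have hrows : (∏ j, polyEmbed i (F j)) *
        ∏ j, ∏ l, (qAlphabet var a ⟨i, k⟩ - qAlphabet var a ⟨i.succAbove j, l⟩) =
          var i ^ (∑ j, a (i.succAbove j)) * ∏ j, pairFactor a i (i.succAbove j) := by
      simp only [← prod_mul_distrib, ← prod_pow_eq_pow_sum, hF]
    have hpow : qAlphabet var a ⟨i, k⟩ ^ (Fintype.card (Σ i, Fin (a i)) - 1) =
        algebraMap K _ ((q ^ (k : ℕ)) ^ (∑ i, a i - 1)) *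
          (var i ^ (a i - 1) * var i ^ (∑ j, a (i.succAbove j))) := by
      rw [← pow_add, ← Nat.sub_add_comm k.pos, ← Fin.sum_univ_succAbove a i, Fintype.card_sigma]
      simp only [Fintype.card_fin, qAlphabet, mul_pow, map_pow, mul_comm]
    rw [prod_sigma_erase, hpow, dysonProd_succAbove a i, map_mul, map_mul, map_prod, polyEmbed_C,
      AlgHom.commutes, map_mul, ← hrow]
    linear_combination (algebraMap K (Laurent (n + 1)) ((q ^ (k : ℕ)) ^ (∑ i, a i - 1)) *
      (algebraMap K _ w * ∏ l ∈ univ.erase k, (qAlphabet var a ⟨i, k⟩ - qAlphabet var a ⟨i, l⟩)) *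
      embed i (dysonProd (a ∘ i.succAbove))) * hrows
  · have hprod : ∏ j, Polynomial.constantCoeff (F j) =
        algebraMap K (Laurent n) (q ^ ∑ j ∈ Ioi i, a j) := by
      simp only [hF0, ← map_prod, prod_pow_eq_pow_sum, sum_ite_lt_succAbove i a fun _ => 0,
        sum_const_zero, zero_add]
    rw [map_mul, map_mul, map_prod, hprod]
    simp only [Polynomial.algebraMap_apply, Polynomial.constantCoeff_apply, Polynomial.coeff_C_zero,
      map_mul]
    ring

end Quotients

section Recursion

variable {n : ℕ}

theorem exists_polynomial_expansion {a : Fin (n + 1) → ℕ} (ha : ∀ i, 0 < a i)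
    (lam : Fin (n + 1) → ℕ) :
    ∃ G : Fin (n + 1) → Polynomial (Laurent n),
      dysonProd a * schurEval lam (qAlphabet var a) =
          ∑ j, var j ^ lam 0 * polyEmbed j (G j) ∧
        ∀ j, Polynomial.constantCoeff (G j) =
          algebraMap K _
              (q ^ (∑ l ∈ Ioi j, a l) * qbin (lam 0 + ∑ i, a i - 1) (a j - 1)) *
            (dysonProd (a ∘ j.succAbove) *
              schurEval (lam ∘ Fin.succ) (qAlphabet var (a ∘ j.succAbove))) := by
  choose B hB hB0 using exists_dysonProd_quotient a
  have : Nonempty (Σ i, Fin (a i)) := ⟨⟨0, ⟨0, ha 0⟩⟩⟩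
  refine ⟨fun j => ∑ k : Fin (a j), algebraMap K _ ((q ^ (k : ℕ)) ^ lam 0) * B j k *
    schurEval (lam ∘ Fin.succ) fun s : {s : Σ i, Fin (a i) // s ≠ ⟨j, k⟩} =>
      qAlphabet (polyVar j) a s, ?_, fun j => ?_⟩
  · rw [mul_schurEval_eq_sum lam (qAlphabet_var_injective a) (dysonProd a)
      (fun s => polyEmbed s.1 (B s.1 s.2)) (fun s => hB s.1 s.2), Fintype.sum_sigma]
    refine sum_congr rfl fun j _ => ?_
    rw [map_sum, mul_sum]
    refine sum_congr rfl fun k _ => ?_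
    have hschur : polyEmbed j (schurEval (lam ∘ Fin.succ)
          fun s : {s : Σ i, Fin (a i) // s ≠ ⟨j, k⟩} => qAlphabet (polyVar j) a s) =
        schurEval (lam ∘ Fin.succ)
          fun s : {s : Σ i, Fin (a i) // s ≠ ⟨j, k⟩} => qAlphabet var a s := by
      simp only [← polyEmbed_qAlphabet j]
      exact map_schurEval (polyEmbed j).toRingHom _ _
    rw [map_mul, map_mul, AlgHom.commutes, hschur, qAlphabet, mul_pow, ← map_pow]
    simp only [mul_assoc]
  · have hn : n ≤ ∑ l, a (j.succAbove l) := by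
      simpa using sum_le_sum fun l (_ : l ∈ univ) => Nat.succ_le_of_lt (ha (j.succAbove l))
    have hle : a j ≤ ∑ i, a i := single_le_sum_of_canonicallyOrdered (mem_univ j)
    have hpos := ha j
    rw [← sum_fin_nodalWeight_q_pow (ha j) (by omega), map_sum, mul_sum, map_sum, sum_mul]
    refine sum_congr rfl fun k _ => ?_
    rw [map_mul, map_mul, hB0, constantCoeff_schurEval j a hn, Nat.add_sub_assoc (by omega),
      pow_add]
    simp only [Polynomial.algebraMap_apply, Polynomial.constantCoeff_apply,
      Polynomial.coeff_C_zero, map_mul]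
    ring

theorem D₂_eq_of_unique_max {a : Fin (n + 1) → ℕ} (ha : ∀ i, 0 < a i)
    {v lam : Fin (n + 1) → ℕ} {i : Fin (n + 1)} (hi : v i = lam 0)
    (hv : ∀ j, j ≠ i → v j < lam 0) :
    D₂ v a (pad (∑ i, a i) lam) =
      q ^ (∑ j ∈ Ioi i, a j) * qbin (lam 0 + ∑ i, a i - 1) (a i - 1) *
        D₂ (v ∘ i.succAbove) (a ∘ i.succAbove)
          (pad (∑ j, (a ∘ i.succAbove) j) (lam ∘ Fin.succ)) := by
  obtain ⟨G, hG, hG0⟩ := exists_polynomial_expansion ha lam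
  have hcoeff (j : Fin (n + 1)) :
      CT (mono (fun j => -(v j : ℤ)) * (var j ^ lam 0 * polyEmbed j (G j))) =
        CT (mono (fun l => -(v (j.succAbove l) : ℤ)) *
          (Polynomial.X ^ lam 0 * G j).coeff (v j)) := by
    rw [← CT_mono_mul_polyEmbed, map_mul, map_pow, polyEmbed_X]
  rw [D₂_pad_eq, D₂_pad_eq, hG, mul_sum, CT_sum, sum_eq_single_of_mem i (mem_univ i)]
  · rw [hcoeff, hi, Polynomial.coeff_X_pow_mul', if_pos le_rfl, Nat.sub_self,
      ← Polynomial.constantCoeff_apply, hG0, mul_left_comm, CT_algebraMap_mul]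
    rfl
  · intro j _ hj
    rw [hcoeff, Polynomial.coeff_X_pow_mul', if_neg (hv j hj).not_ge, mul_zero]
    simp [CT]

end Recursion

section Permutations

variable {n : ℕ}

theorem dominant_permute_bar {lam : Fin n → ℕ} (h : Antitone lam) (w : Equiv.Perm (Fin n)) :
    dominant (permute w (bar lam)) = lam := by
  have hbar : permute w (bar lam) ∘ ⇑w⁻¹ = bar lam := by
    ext i
    simp [permute]
  have hmono : Monotone (permute w (bar lam) ∘ ⇑w⁻¹) := by
    rw [hbar]
    exact fun i j hij => h (Fin.rev_le_rev.mpr hij)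
  have hsort := Tuple.comp_sort_eq_comp_iff_monotone.mpr hmono
  ext i
  simpa [bar, dominant] using congrFun (hsort.symm.trans hbar) i.rev

/-- The permutation of `{1, …, n}` obtained from a permutation `w` of `{1, …, n + 1}`, written as
the word `w(1) ⋯ w(n + 1)`, by deleting the last letter and standardizing. -/
def removeLast (w : Equiv.Perm (Fin (n + 1))) : Equiv.Perm (Fin n) :=
  (finSuccAboveEquiv (Fin.last n)).trans <|
    (w.subtypeEquiv fun _ => w.apply_eq_iff_eq.not.symm).trans
      (finSuccAboveEquiv (w (Fin.last n))).symm

theorem succAbove_removeLast (w : Equiv.Perm (Fin (n + 1))) (j : Fin n) :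
    (w (Fin.last n)).succAbove (removeLast w j) = w j.castSucc := by
  rw [← Fin.succAbove_last_apply]
  exact congrArg Subtype.val ((finSuccAboveEquiv (w (Fin.last n))).apply_symm_apply _)

theorem inv_succAbove (w : Equiv.Perm (Fin (n + 1))) (j : Fin n) :
    w⁻¹ ((w (Fin.last n)).succAbove j) = ((removeLast w)⁻¹ j).castSucc := by
  rw [Equiv.Perm.inv_eq_iff_eq, ← succAbove_removeLast, ← Equiv.Perm.mul_apply, mul_inv_cancel,
    Equiv.Perm.one_apply]

theorem permute_inv_bar_comp_succAbove (w : Equiv.Perm (Fin (n + 1))) (lam : Fin (n + 1) → ℕ) :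
    permute w⁻¹ (bar lam) ∘ (w (Fin.last n)).succAbove =
      permute (removeLast w)⁻¹ (bar (lam ∘ Fin.succ)) := by
  ext j
  simp only [permute, bar, Function.comp_apply, inv_succAbove, Fin.rev_castSucc]

theorem permute_inv_bar_last (w : Equiv.Perm (Fin (n + 1))) (lam : Fin (n + 1) → ℕ) :
    permute w⁻¹ (bar lam) (w (Fin.last n)) = lam 0 := by
  simp [permute, bar]

theorem permute_comp_castSucc (w : Equiv.Perm (Fin (n + 1))) (a : Fin (n + 1) → ℕ) :
    permute w a ∘ Fin.castSucc = permute (removeLast w) (a ∘ (w (Fin.last n)).succAbove) := by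
  ext j
  simp only [permute, Function.comp_apply, succAbove_removeLast]

theorem partialSum_permute_last (w : Equiv.Perm (Fin (n + 1))) (a : Fin (n + 1) → ℕ) :
    partialSum (permute w a) (Fin.last n) = ∑ i, a i := by
  rw [partialSum, ← Fin.top_eq_last, Iic_top]
  exact Equiv.sum_comp w a

theorem partialSum_castSucc (a : Fin (n + 1) → ℕ) (j : Fin n) :
    partialSum a j.castSucc = partialSum (a ∘ Fin.castSucc) j := by
  rw [partialSum, partialSum, ← Fin.map_castSuccEmb_Iic, sum_map]
  rfl

theorem sum_R_succ (w : Equiv.Perm (Fin (n + 1))) (a : Fin (n + 1) → ℕ) :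
    ∑ p ∈ R w, a p.2 = ∑ j ∈ Ioi (w (Fin.last n)), a j +
      ∑ p ∈ R (removeLast w), a ((w (Fin.last n)).succAbove p.2) := by
  have hinv : w⁻¹ (w (Fin.last n)) = Fin.last n := Equiv.Perm.inv_eq_iff_eq.mpr rfl
  have hlast (j : Fin n) : ¬ Fin.last n < j.castSucc := (Fin.le_last _).not_gt
  simp only [R, inversionSet, sum_filter]
  rw [sum_pairs_succ (w (Fin.last n)) fun i j => if w⁻¹ j < w⁻¹ i then a j else 0]
  simp only [hinv, hlast, inv_succAbove, Fin.castSucc_lt_last, if_true,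
    if_false, Fin.castSucc_lt_castSucc_iff, sum_ite_lt_succAbove _ a fun _ => 0, sum_const_zero,
    zero_add]

theorem D₂_permute_bar {n : ℕ} {lam : Fin n → ℕ} (hlam : StrictAnti lam) {a : Fin n → ℕ}
    (ha : ∀ i, 0 < a i) (w : Equiv.Perm (Fin n)) :
    D₂ (permute w⁻¹ (bar lam)) a (pad (∑ i, a i) lam) =
      (∏ i, qbin (bar lam i + partialSum (permute w a) i - 1) (permute w a i - 1)) *
        q ^ (∑ p ∈ R w, a p.2) := by
  induction n with
  | zero =>
    rw [D₂_pad_eq, schurEval_of_isEmpty, Subsingleton.elim (fun i => -_) (0 : Fin 0 → ℤ)]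
    simp [dysonProd, pairs, R, inversionSet, mono, CT]
  | succ n ih =>
    have hmax (j : Fin (n + 1)) (hj : j ≠ w (Fin.last n)) :
        permute w⁻¹ (bar lam) j < lam 0 := by
      refine hlam (Fin.pos_iff_ne_zero.mpr fun h => hj ?_)
      rw [← Equiv.Perm.inv_eq_iff_eq, ← Fin.rev_inj, h, Fin.rev_last]
    rw [D₂_eq_of_unique_max ha (permute_inv_bar_last w lam) hmax, permute_inv_bar_comp_succAbove,
      ih (hlam.comp_strictMono Fin.strictMono_succ) (a := a ∘ (w (Fin.last n)).succAbove)
        (fun _ => ha _),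
      Fin.prod_univ_castSucc, partialSum_permute_last, sum_R_succ, pow_add]
    simp only [bar, Fin.rev_last, Fin.rev_castSucc, partialSum_castSucc, permute_comp_castSucc,
      Function.comp_apply, permute, succAbove_removeLast]
    ring

theorem permute_revPerm_inv_bar (lam : Fin n → ℕ) : permute Fin.revPerm⁻¹ (bar lam) = lam := by
  ext i
  simp [permute, bar, Equiv.Perm.inv_def]

theorem R_revPerm (n : ℕ) : R (Fin.revPerm : Equiv.Perm (Fin n)) = pairs n :=
  filter_true_of_mem fun p hp => by simpa [pairs, Equiv.Perm.inv_def] using hp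

theorem partialSum_permute_revPerm (a : Fin n → ℕ) (i : Fin n) :
    partialSum (permute Fin.revPerm a) i.rev = ∑ j ∈ Ici i, a j := by
  rw [partialSum, ← Fin.map_revPerm_Ici, sum_map]
  exact sum_congr rfl fun j _ => by simp [permute]

end Permutations

end

end QDyson

theorem proposition4p7 (n : ℕ) (lam : Fin n → ℕ) (hlam : StrictAnti lam)
    (a : Fin n → ℕ) (ha : ∀ i, 0 < a i) :
    (∀ w : Equiv.Perm (Fin n),
      QDyson.D (QDyson.permute w⁻¹ (QDyson.bar lam)) a =
        (∏ i, QDyson.qbin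
          (QDyson.bar lam i + QDyson.partialSum (QDyson.permute w a) i - 1)
          (QDyson.permute w a i - 1)) *
        QDyson.q ^ (∑ p ∈ QDyson.R w, a p.2)) ∧
    QDyson.D₂ lam a (QDyson.pad (∑ i, a i) lam) =
      QDyson.q ^ (∑ p ∈ QDyson.pairs n, a p.2) *
        ∏ i, QDyson.qbin (lam i + (∑ j ∈ Finset.Ici i, a j) - 1) (a i - 1) := by
  refine ⟨fun w => ?_, ?_⟩
  · rw [QDyson.D, QDyson.dominant_permute_bar hlam.antitone]
    exact QDyson.D₂_permute_bar hlam ha w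
  · have hrev := QDyson.D₂_permute_bar hlam ha Fin.revPerm
    rw [QDyson.permute_revPerm_inv_bar, QDyson.R_revPerm, mul_comm,
      ← Equiv.prod_comp Fin.revPerm] at hrev
    simpa only [Fin.revPerm_apply, QDyson.partialSum_permute_revPerm, QDyson.bar, QDyson.permute,
      Fin.rev_rev] using hrev
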